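/- Let $G$ be a finitely generated free abelian group and let $A \subset G$ be a finite generating set with $A = -A$ and $0 \notin A$. Let $\Gamma = \mathrm{Cay}(G, A)$ be the (undirected) Cayley graph, with vertex set $G$ and edges $\{x, x + a\}$ for $x \in G$, $a \in A$. For an integer $r \ge 0$ let $B_r$ be the subgraph of $\Gamma$ induced by the vertices at path distance at most $r$ from $0$ in $\Gamma$. Then there is an integer $R(A) \ge 0$ such that for every integer $r \ge R(A)$ and every graph automorphism $\varphi$ of $B_r$: (1) $\varphi$ is linear: for every identification of $G$ with $\mathbb{Z}^k \subset \mathbb{R}^k$ by a group isomorphism, there is a non-degenerate (invertible) linear map $T : \mathbb{R}^k \to \mathbb{R}^k$ with $\varphi(x) = T(x)$ for all vertices $x$ of $B_r$; (2) there is exactly one graph automorphism $\psi$ of $\Gamma$ with $\psi(0) = 0$ whose restriction to the vertices of $B_r$ is $\varphi$. -/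

import Mathlib

/-- The closed ball of radius `r` around the origin for the word metric of `G` with respect to
`A`, i.e. for the path metric of the Cayley graph `Cay(G, A)`. -/
def wordBallVerts {G : Type*} [AddCommGroup G] (A : Set G) (r : ℕ) : Set G :=
  {x : G | (SimpleGraph.addCayley A).edist 0 x ≤ (r : ℕ∞)}

/-- The graph `B_r`: the subgraph of `Cay(G, A)` induced on the closed ball of radius `r`. -/
def wordBall {G : Type*} [AddCommGroup G] (A : Set G) (r : ℕ) :
    SimpleGraph (wordBallVerts A r) :=
  (SimpleGraph.addCayley A).induce (wordBallVerts A r)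

/-- A self-map `f` of a subset `S` of `G` is linear, where `G` is identified with the lattice
`ℤ^k ⊆ ℝ^k` through `e`: it agrees on `S` with a non-degenerate linear map `T : ℝ^k → ℝ^k`. -/
def IsLinearInCoords {G : Type*} [AddCommGroup G] {k : ℕ} (e : G ≃+ (Fin k → ℤ)) {S : Set G}
    (f : S → S) : Prop :=
  ∃ T : (Fin k → ℝ) ≃ₗ[ℝ] (Fin k → ℝ),
    ∀ x : S, (fun i => ((e (f x : G) i : ℤ) : ℝ)) = T (fun i => ((e (x : G) i : ℤ) : ℝ))

/-!
Write `n = #A` and let `|x|` be the word length. The argument rests on the generators `a ∈ A` that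
are not midpoints of two other generators. For such `a` the vertices `x` and `x + 2a` have the
unique common neighbour `x + a`. A strict convexity argument shows that every `x` with `|x| > n` has
a geodesic word in which such an `a` occurs twice (`IsSymmGenSet.exists_isNonMidpoint`).

Let `f` be an automorphism of a large ball. Deep inside the ball, uniqueness of the common neighbour
makes `f` map straight paths in a non-midpoint direction `a` to straight paths. Two such paths at
distance `1` have images at distance `1`, hence parallel images (`IsBallMap.parallel`). So for a
generator `c` the increment `g x = f (x + c) - f x` is invariant under steps in non-midpoint
directions. As `f` maps the star of `x` bijectively onto the star of `f x`, the sum of `f` over the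
neighbours of `x` is `n • f x` plus a constant, and therefore `g` is harmonic. Since every point of
a far enough sphere is moved inwards by a non-midpoint direction, the maximum principle applies and
`g` is constant (`IsSymmGenSet.eq_of_harmonic`, `IsBallMap.map_add`).

Thus `f` is affine along generators on a large smaller ball. The lattice of relations between the
generators is finitely generated, so the linear part extends to an endomorphism `T` of `G`
(`IsSymmGenSet.exists_addMonoidHom`), which permutes `A` and hence is an automorphism. The map
`T⁻¹ ∘ f` is a translation on the smaller ball; sphere by sphere, the neighbours of a point that are
already under control force it to be a translation on the whole ball
(`IsBallMap.eq_add_of_forall_le`), and a finite nonempty ball is only invariant under the trivial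
translation. This gives `f = T` on the ball (`IsSymmGenSet.exists_addEquiv`). Uniqueness of the
extension to the whole graph follows from the same statement for larger and larger balls.
-/

section

open SimpleGraph

variable {G : Type*} [AddCommGroup G]

/-! ### Word length -/

/-- A finite set `A` of nonzero elements of `G` that is closed under negation and generates `G`. -/
structure IsSymmGenSet (A : Finset G) : Prop where
  neg_mem : ∀ a ∈ A, -a ∈ A
  zero_notMem : (0 : G) ∉ A
  closure_eq : AddSubgroup.closure (A : Set G) = ⊤

/-- The word length of `x` with respect to `A`: its distance from `0` in `Cay(G, A)`. -/
noncomputable def wordLength (A : Finset G) (x : G) : ℕ := (addCayley (A : Set G)).dist 0 x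

/-- `a ∈ A` is not the midpoint of two other elements of `A`. Equivalently, `x + a` is the only
common neighbour of `x` and `x + 2a` in `Cay(G, A)`. -/
def IsNonMidpoint (A : Finset G) (a : G) : Prop :=
  a ∈ A ∧ ∀ b ∈ A, ∀ c ∈ A, b + c = a + a → b = a

namespace IsSymmGenSet

variable {A : Finset G}

lemma adj_iff (hA : IsSymmGenSet A) {x y : G} :
    (addCayley (A : Set G)).Adj x y ↔ y - x ∈ A := by
  rw [addCayley_adj']
  constructor
  · rintro ⟨-, g, hg, rfl | rfl⟩
    · simpa using hg
    · simpa using hA.neg_mem g hg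
  · intro h
    refine ⟨?_, y - x, h, Or.inl (by abel)⟩
    rintro rfl
    exact hA.zero_notMem (by simpa using h)

lemma neg_mem_iff (hA : IsSymmGenSet A) {x : G} : -x ∈ A ↔ x ∈ A :=
  ⟨fun h => by simpa using hA.neg_mem _ h, hA.neg_mem x⟩

lemma sub_mem_comm (hA : IsSymmGenSet A) {x y : G} : x - y ∈ A ↔ y - x ∈ A := by
  rw [← hA.neg_mem_iff, neg_sub]

lemma reachable (hA : IsSymmGenSet A) (u x : G) :
    (addCayley (A : Set G)).Reachable u (u + x) := by
  have hx : x ∈ AddSubgroup.closure (A : Set G) := by simp [hA.closure_eq]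
  induction hx using AddSubgroup.closure_induction generalizing u with
  | mem a ha => exact (hA.adj_iff.2 (by simpa using ha)).reachable
  | zero => simp
  | add x y _ _ hx hy => exact (hx u).trans (by simpa [add_assoc] using hy (u + x))
  | neg x _ hx => exact (by simpa using hx (u + -x) : Reachable _ (u + -x) u).symm

lemma connected (hA : IsSymmGenSet A) : (addCayley (A : Set G)).Connected :=
  (connected_iff _).2 ⟨fun u v => by simpa using hA.reachable u (v - u), ⟨0⟩⟩

lemma edist_le_iff (hA : IsSymmGenSet A) {x : G} {r : ℕ} :
    (addCayley (A : Set G)).edist 0 x ≤ (r : ℕ∞) ↔ wordLength A x ≤ r := by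
  rw [← (hA.connected 0 x).coe_dist_eq_edist, Nat.cast_le, wordLength]

@[simp] lemma wordLength_zero : wordLength A 0 = 0 := by simp [wordLength]

lemma eq_zero_of_wordLength (hA : IsSymmGenSet A) {x : G} (h : wordLength A x = 0) : x = 0 :=
  (hA.connected.dist_eq_zero_iff.1 h).symm

lemma wordLength_add_le (hA : IsSymmGenSet A) (x : G) {a : G} (ha : a ∈ A) :
    wordLength A (x + a) ≤ wordLength A x + 1 := by
  refine (hA.connected.dist_triangle (v := x)).trans ?_
  gcongr
  · exact le_rfl
  · exact (dist_eq_one_iff_adj.2 (hA.adj_iff.2 (by simpa using ha))).le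

lemma wordLength_le_of_sub_mem (hA : IsSymmGenSet A) {x y : G} (h : y - x ∈ A) :
    wordLength A y ≤ wordLength A x + 1 := by
  simpa using hA.wordLength_add_le x h

lemma exists_wordLength_sub (hA : IsSymmGenSet A) {x : G} (h : wordLength A x ≠ 0) :
    ∃ a ∈ A, wordLength A (x - a) + 1 = wordLength A x := by
  obtain ⟨p, hp⟩ := hA.connected.exists_walk_length_eq_dist x 0
  cases p with
  | nil => simp at h
  | @cons _ v _ hadj q =>
    have h1 : x - v ∈ A := hA.sub_mem_comm.1 (hA.adj_iff.1 hadj)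
    refine ⟨x - v, h1, ?_⟩
    have h2 : wordLength A x = q.length + 1 := by
      rw [wordLength, dist_comm, ← hp, Walk.length_cons]
    have h3 : wordLength A v ≤ q.length := by
      rw [wordLength, dist_comm]; exact dist_le q
    have h4 := hA.wordLength_le_of_sub_mem h1
    rw [sub_sub_cancel]
    omega

lemma wordLength_add_sum_le (hA : IsSymmGenSet A) (x : G) (m : Multiset G) (hm : ∀ a ∈ m, a ∈ A) :
    wordLength A (x + m.sum) ≤ wordLength A x + Multiset.card m := by
  induction m using Multiset.induction_on generalizing x with
  | empty => simp
  | cons a m ih =>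
    have h1 := ih (x + a) fun b hb => hm b (Multiset.mem_cons_of_mem hb)
    have h2 := hA.wordLength_add_le x (hm a (Multiset.mem_cons_self a m))
    rw [Multiset.sum_cons, Multiset.card_cons, ← add_assoc]
    omega

lemma exists_multiset (hA : IsSymmGenSet A) (x : G) :
    ∃ m : Multiset G, (∀ a ∈ m, a ∈ A) ∧ Multiset.card m = wordLength A x ∧ m.sum = x := by
  induction hn : wordLength A x generalizing x with
  | zero => exact ⟨0, by simp, by simp, by simp [hA.eq_zero_of_wordLength hn]⟩
  | succ n ih =>
    obtain ⟨a, ha, h⟩ := hA.exists_wordLength_sub (x := x) (by omega)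
    obtain ⟨m, h1, h2, h3⟩ := ih (x - a) (by omega)
    refine ⟨a ::ₘ m, ?_, by simp [h2], by simp [h3]⟩
    intro b hb
    rcases Multiset.mem_cons.1 hb with rfl | hb
    · exact ha
    · exact h1 b hb

lemma wordLength_add_le_add (hA : IsSymmGenSet A) (x y : G) :
    wordLength A (x + y) ≤ wordLength A x + wordLength A y := by
  obtain ⟨m, h1, h2, rfl⟩ := hA.exists_multiset y
  rw [← h2]
  exact hA.wordLength_add_sum_le x m h1

/-- The multisets of `n` elements of `A` are bounded by `n • A`, so there are finitely many. -/
lemma finite_multiset {M : Type*} (A : Finset M) (n : ℕ) :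
    {m : Multiset M | (∀ a ∈ m, a ∈ A) ∧ Multiset.card m = n}.Finite := by
  classical
  refine (Set.finite_Iic (n • A.val)).subset ?_
  rintro m ⟨h1, h2⟩
  rw [Set.mem_Iic, Multiset.le_iff_count]
  intro a
  by_cases ha : a ∈ m
  · rw [Multiset.count_nsmul, Multiset.count_eq_one_of_mem A.nodup (h1 a ha), mul_one, ← h2]
    exact Multiset.count_le_card a m
  · simp [Multiset.count_eq_zero_of_notMem ha]

lemma finite_ball (hA : IsSymmGenSet A) (r : ℕ) : {x : G | wordLength A x ≤ r}.Finite := by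
  refine ((Set.finite_Iic r).biUnion fun n _ =>
    (finite_multiset A n).image Multiset.sum).subset ?_
  intro x hx
  obtain ⟨m, h1, h2, h3⟩ := hA.exists_multiset x
  exact Set.mem_biUnion (x := wordLength A x) hx ⟨m, ⟨h1, h2⟩, h3⟩

/-! ### Geodesics through non-midpoints -/

/-- The squared Euclidean norm in the coordinates of a chosen basis of `G`. -/
noncomputable def sqNorm [Module.Free ℤ G] [Module.Finite ℤ G] (x : G) : ℤ :=
  ∑ i, ((Module.Free.chooseBasis ℤ G).repr x i) ^ 2

section

variable [Module.Free ℤ G] [Module.Finite ℤ G]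

/-- Strict convexity of `sqNorm`. -/
lemma sqNorm_lt {a b c : G} (h : b + c = a + a) (hb : b ≠ a) :
    sqNorm a + sqNorm a < sqNorm b + sqNorm c := by
  obtain rfl : c = a + a - b := by rw [← h]; abel
  have key : sqNorm b + sqNorm (a + a - b) - (sqNorm a + sqNorm a) = 2 * sqNorm (b - a) := by
    simp only [sqNorm, Finset.mul_sum, ← Finset.sum_add_distrib, ← Finset.sum_sub_distrib]
    refine Finset.sum_congr rfl fun i _ => ?_
    simp only [map_sub, map_add, Finsupp.coe_sub, Finsupp.coe_add, Pi.sub_apply, Pi.add_apply]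
    ring
  have hpos : 0 < sqNorm (b - a) := by
    refine lt_of_le_of_ne (Finset.sum_nonneg fun i _ => sq_nonneg _) fun h0 => hb ?_
    have h1 := (Finset.sum_eq_zero_iff_of_nonneg fun i _ => sq_nonneg _).1 h0.symm
    rw [← sub_eq_zero]
    refine (Module.Free.chooseBasis ℤ G).ext_elem fun i => ?_
    simpa using h1 i (Finset.mem_univ i)
  linarith

/-- A long element has a geodesic word containing a non-midpoint twice: in a geodesic word that
maximizes the sum of the squared norms, a letter repeated twice cannot be a midpoint, by strict
convexity, and a word longer than `#A` repeats a letter. -/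
lemma exists_isNonMidpoint (hA : IsSymmGenSet A) {x : G} (hx : A.card < wordLength A x) :
    ∃ a, IsNonMidpoint A a ∧ wordLength A (x - (a + a)) + 2 ≤ wordLength A x := by
  classical
  have hfin : {m : Multiset G | ((∀ a ∈ m, a ∈ A) ∧ Multiset.card m = wordLength A x) ∧
      m.sum = x}.Finite := (finite_multiset A _).subset fun m hm => hm.1
  obtain ⟨m, ⟨⟨hm1, hm2⟩, hm3⟩, hmax⟩ := hfin.exists_maximalFor
    (fun m => (m.map sqNorm).sum) _ (by
      obtain ⟨m, h1, h2, h3⟩ := hA.exists_multiset x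
      exact ⟨m, ⟨h1, h2⟩, h3⟩)
  obtain ⟨a, ha⟩ : ∃ a, 2 ≤ m.count a := by
    by_contra! h
    have h1 : m ≤ A.val := (Multiset.le_iff_subset (Multiset.nodup_iff_count_le_one.2 fun a => by
      have := h a; omega)).2 hm1
    have h2 := Multiset.card_le_card h1
    rw [hm2, Finset.card_val] at h2
    omega
  have hle : a ::ₘ a ::ₘ 0 ≤ m := by
    rw [Multiset.le_iff_count]
    intro b
    by_cases hb : b = a
    · subst hb; simpa using ha
    · simp [hb]
  obtain ⟨m', rfl⟩ := Multiset.le_iff_exists_add.1 hle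
  have hm' : ∀ b ∈ m', b ∈ A := fun b hb => hm1 b (by simp [hb])
  refine ⟨a, ⟨hm1 a (by simp), fun b hb c hc hbc => ?_⟩, ?_⟩
  · by_contra hne
    have h1 := sqNorm_lt hbc hne
    have h2 := @hmax (b ::ₘ c ::ₘ m') ⟨⟨?_, ?_⟩, ?_⟩ ?_
    · simp at h2
      linarith
    · simp only [Multiset.mem_cons]
      rintro d (rfl | rfl | hd)
      exacts [hb, hc, hm' d hd]
    · simpa using hm2
    · rw [← hm3]
      simp [← add_assoc, hbc]
    · simp
      linarith
  · have h1 := hA.wordLength_add_sum_le 0 m' hm'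
    have h2 : x - (a + a) = 0 + m'.sum := by rw [← hm3]; simp [← add_assoc]
    rw [h2, ← hm2]
    simp at h1 ⊢
    omega

end

end IsSymmGenSet

/-! ### Automorphisms of balls -/

/-- `f` restricts to a graph embedding of the ball of radius `r` of `Cay(G, A)` into itself (hence,
the ball being finite, to an automorphism). The values of `f` outside the ball are irrelevant. -/
structure IsBallMap (A : Finset G) (r : ℕ) (f : G → G) : Prop where
  maps : ∀ x, wordLength A x ≤ r → wordLength A (f x) ≤ r
  inj : ∀ x y, wordLength A x ≤ r → wordLength A y ≤ r → f x = f y → x = y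
  adj : ∀ x y, wordLength A x ≤ r → wordLength A y ≤ r → (f y - f x ∈ A ↔ y - x ∈ A)

namespace IsBallMap

variable {A : Finset G} {r : ℕ} {f : G → G}

lemma sub_mem (hA : IsSymmGenSet A) (hf : IsBallMap A r f) {x a : G}
    (hx : wordLength A x + 1 ≤ r) (ha : a ∈ A) : f (x + a) - f x ∈ A :=
  (hf.adj x (x + a) (by omega) ((hA.wordLength_add_le x ha).trans hx)).2 (by simpa using ha)

lemma bijOn_star (hA : IsSymmGenSet A) (hf : IsBallMap A r f) {x : G}
    (hx : wordLength A x + 1 ≤ r) : Set.BijOn (fun a => f (x + a) - f x) A A := by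
  have hmaps : Set.MapsTo (fun a => f (x + a) - f x) (A : Set G) A :=
    fun a ha => hf.sub_mem hA hx ha
  have hinj : Set.InjOn (fun a => f (x + a) - f x) (A : Set G) := by
    intro a ha b hb hab
    have h := hf.inj (x + a) (x + b) ((hA.wordLength_add_le x ha).trans hx)
      ((hA.wordLength_add_le x hb).trans hx) (sub_left_injective hab)
    exact add_left_cancel h
  exact ⟨hmaps, hinj, Finset.surjOn_of_injOn_of_card_le _ hmaps hinj le_rfl⟩

lemma exists_star (hA : IsSymmGenSet A) (hf : IsBallMap A r f) {x b : G}
    (hx : wordLength A x + 1 ≤ r) (hb : b ∈ A) : ∃ a ∈ A, f (x + a) = f x + b := by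
  obtain ⟨a, ha, h⟩ := (hf.bijOn_star hA hx).surjOn hb
  exact ⟨a, ha, by rw [← h]; simp⟩

lemma sum_star (hA : IsSymmGenSet A) (hf : IsBallMap A r f) {x : G}
    (hx : wordLength A x + 1 ≤ r) : ∑ a ∈ A, f (x + a) = A.card • f x + ∑ a ∈ A, a := by
  have h := hf.bijOn_star hA hx
  have h1 : ∑ a ∈ A, (f (x + a) - f x) = ∑ a ∈ A, a :=
    Finset.sum_nbij _ h.mapsTo h.injOn h.surjOn fun _ _ => rfl
  rw [Finset.sum_sub_distrib, Finset.sum_const] at h1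
  rw [← h1]; abel

/-- A two-step path in a non-midpoint direction is mapped to a straight path, since its middle
vertex is the only common neighbour of its ends. -/
lemma two_step (hA : IsSymmGenSet A) (hf : IsBallMap A r f) {x a : G}
    (ha : IsNonMidpoint A a) (hx : wordLength A x + 2 ≤ r) :
    f (x + a + a) - f (x + a) = f (x + a) - f x := by
  have h1 := hA.wordLength_add_le x ha.1
  have h2 := hA.wordLength_add_le (x + a) ha.1
  have hc : f (x + a + a) - f (x + a) ∈ A := hf.sub_mem hA (by omega) ha.1
  obtain ⟨a', ha', h⟩ := hf.exists_star hA (x := x) (by omega) hc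
  have h3 := hA.wordLength_add_le x ha'
  have h4 : (x + a + a) - (x + a') ∈ A := by
    rw [← hf.adj _ _ (by omega) (by omega), h]
    have h5 := hf.sub_mem hA (x := x) (by omega) ha.1
    convert h5 using 1
    abel
  obtain rfl : a' = a := ha.2 a' ha' _ h4 (by abel)
  rw [eq_sub_of_add_eq' h.symm]

lemma ray (hA : IsSymmGenSet A) (hf : IsBallMap A r f) {x a : G}
    (ha : IsNonMidpoint A a) {k : ℕ} (hx : wordLength A x + k ≤ r) :
    f (x + k • a) = f x + k • (f (x + a) - f x) := by
  have hstep : ∀ k, wordLength A x + k + 1 ≤ r →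
      f (x + (k + 1) • a) - f (x + k • a) = f (x + a) - f x := by
    intro k
    induction k with
    | zero => intro _; simp
    | succ k ih =>
      intro hk
      rw [← ih (by omega)]
      have h1 := hA.wordLength_add_sum_le x (Multiset.replicate k a)
        (fun b hb => Multiset.eq_of_mem_replicate hb ▸ ha.1)
      rw [Multiset.sum_replicate, Multiset.card_replicate] at h1
      have h2 := hf.two_step hA ha (x := x + k • a) (by omega)
      simpa only [add_smul, one_smul, add_assoc] using h2
  induction k with
  | zero => simp
  | succ k ih =>
    rw [eq_add_of_sub_eq (hstep k (by omega)), ih (by omega), succ_nsmul]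
    abel

/-- Parallel rays in a non-midpoint direction are mapped to parallel rays: the images of two
neighbouring rays stay adjacent, and their difference would otherwise take more than `#A` values
in `A`. -/
lemma parallel [Module.Free ℤ G] (hA : IsSymmGenSet A) (hf : IsBallMap A r f) {x a c : G}
    (ha : IsNonMidpoint A a) (hc : c ∈ A) (hx : wordLength A x + A.card + 1 ≤ r) :
    f (x + a + c) - f (x + a) = f (x + c) - f x := by
  by_contra hne
  have h1 := hA.wordLength_add_le x hc
  set d := (f (x + c + a) - f (x + c)) - (f (x + a) - f x) with hd
  have hd0 : d ≠ 0 := by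
    intro h0
    apply hne
    rw [add_right_comm x a c, ← sub_eq_zero, ← h0, hd]
    abel
  have hmem : ∀ k ∈ Finset.range (A.card + 1), (f (x + c) - f x) + k • d ∈ A := by
    intro k hk
    rw [Finset.mem_range] at hk
    have h2 := hA.wordLength_add_sum_le x (Multiset.replicate k a)
      (fun b hb => Multiset.eq_of_mem_replicate hb ▸ ha.1)
    rw [Multiset.sum_replicate, Multiset.card_replicate] at h2
    have h3 := hf.sub_mem hA (x := x + k • a) (by omega) hc
    rw [add_right_comm, hf.ray hA ha (by omega), hf.ray hA ha (by omega)] at h3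
    convert h3 using 1
    rw [hd, smul_sub]
    abel
  have hcard := Finset.card_le_card_of_injOn _ hmem (by
    intro k _ l _ hkl
    have h4 : (k : ℤ) • d = (l : ℤ) • d := by simpa using add_left_cancel hkl
    exact_mod_cast smul_left_injective ℤ hd0 h4)
  simp at hcard

end IsBallMap

/-! ### Harmonicity and local affinity -/

variable {A : Finset G}

/-- A form of the maximum principle: a function on the ball of radius `s` that is harmonic on its
interior and invariant under steps in non-midpoint directions is constant. The invariance moves a
maximum on the bounding sphere into the interior. -/
lemma IsSymmGenSet.eq_of_harmonic [Module.Free ℤ G] [Module.Finite ℤ G] (hA : IsSymmGenSet A)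
    {s : ℕ} (hs : A.card < s) {h : G → ℤ}
    (harm : ∀ x, wordLength A x < s → ∑ a ∈ A, h (x + a) = A.card • h x)
    (per : ∀ x a, IsNonMidpoint A a → wordLength A x < s → h (x + a) = h x)
    {x : G} (hx : wordLength A x ≤ s) : h x = h 0 := by
  have spread : ∀ x, (∀ y, wordLength A y ≤ s → h y ≤ h x) → wordLength A x < s →
      ∀ a ∈ A, h (x + a) = h x := by
    intro x hmax hxs a ha
    have h0 : ∑ a ∈ A, (h x - h (x + a)) = 0 := by
      rw [Finset.sum_sub_distrib, harm x hxs, Finset.sum_const, sub_self]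
    have h1 := (Finset.sum_eq_zero_iff_of_nonneg fun b hb => sub_nonneg.2
      (hmax _ ((hA.wordLength_add_le x hb).trans hxs))).1 h0 a ha
    linarith
  have descend : ∀ n x, wordLength A x = n → n ≤ s → (∀ y, wordLength A y ≤ s → h y ≤ h x) →
      h x = h 0 := by
    intro n
    induction n using Nat.strong_induction_on with
    | _ n ih =>
      intro x hxn hns hmax
      rcases Nat.eq_zero_or_pos n with rfl | hn
      · rw [hA.eq_zero_of_wordLength hxn]
      · obtain ⟨y, hy, hyx⟩ : ∃ y, wordLength A y < n ∧ h y = h x := by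
          rcases hns.lt_or_eq with hlt | rfl
          · obtain ⟨a, ha, h1⟩ := hA.exists_wordLength_sub (x := x) (by omega)
            refine ⟨x - a, by omega, ?_⟩
            rw [sub_eq_add_neg]
            exact spread x hmax (by omega) _ (hA.neg_mem a ha)
          · obtain ⟨a, ha, h1⟩ := hA.exists_isNonMidpoint (x := x) (by omega)
            have h2 := hA.wordLength_add_le (x - (a + a)) ha.1
            rw [sub_add_eq_sub_sub, sub_add_cancel] at h2
            rw [sub_add_eq_sub_sub] at h1
            refine ⟨x - a, by omega, ?_⟩
            rw [← per (x - a) a ha (by omega), sub_add_cancel]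
        rw [← hyx]
        exact ih _ hy y rfl (by omega) (by rwa [hyx])
  obtain ⟨x₀, hx₀, hmax⟩ := (hA.finite_ball s).exists_maximalFor h _ ⟨0, by simp⟩
  have hmax' : ∀ y, wordLength A y ≤ s → h y ≤ h x₀ := fun y hy =>
    (le_total (h y) (h x₀)).elim id fun hle => hmax hy hle
  have h0 := descend _ x₀ rfl hx₀ hmax'
  have ascend : ∀ n x, wordLength A x = n → n ≤ s → h x = h 0 := by
    intro n
    induction n with
    | zero => intro x hxn _; rw [hA.eq_zero_of_wordLength hxn]
    | succ n ih =>
      intro x hxn hns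
      obtain ⟨a, ha, h1⟩ := hA.exists_wordLength_sub (x := x) (by omega)
      have h2 := ih (x - a) (by omega) (by omega)
      rw [← h2, ← spread (x - a) (by rwa [h2, ← h0]) (by omega) a ha, sub_add_cancel]
  exact ascend _ x rfl hx

namespace IsBallMap

variable {r : ℕ} {f : G → G}

/-- On a smaller ball the increment of `f` along a generator is constant: as a function of the base
point it is harmonic, because `f` maps stars onto stars, and invariant in non-midpoint directions,
because `f` preserves parallelism of rays. -/
lemma map_add [Module.Free ℤ G] [Module.Finite ℤ G] (hA : IsSymmGenSet A) (hf : IsBallMap A r f)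
    {s : ℕ} (hs : A.card < s) (hr : s + A.card + 1 ≤ r) {x c : G}
    (hx : wordLength A x ≤ s) (hc : c ∈ A) : f (x + c) = f x + (f c - f 0) := by
  rw [← sub_eq_iff_eq_add']
  refine (Module.Free.chooseBasis ℤ G).ext_elem fun i => ?_
  set l := (Module.Free.chooseBasis ℤ G).coord i with hl
  have key := hA.eq_of_harmonic hs (h := fun x => l (f (x + c) - f x)) ?_ ?_ hx
  · simpa [hl] using key
  · intro x hx
    have h1 := hA.wordLength_add_le x hc
    rw [← map_sum, ← map_nsmul, Finset.sum_sub_distrib, hf.sum_star hA (x := x) (by omega)]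
    simp_rw [add_right_comm x _ c]
    rw [hf.sum_star hA (by omega), smul_sub]
    congr 1
    abel
  · intro x a ha hx
    exact congrArg l (hf.parallel hA ha hc (by omega))

end IsBallMap

/-! ### Extension to a group homomorphism -/

/-- The relations between the generators in `A` are generated by finitely many of them, so a map
that respects the generators on a large enough ball respects all relations. -/
lemma IsSymmGenSet.exists_addMonoidHom (hA : IsSymmGenSet A) :
    ∃ N : ℕ, ∀ s, N ≤ s → ∀ f τ : G → G,
      (∀ x, wordLength A x ≤ s → ∀ c ∈ A, f (x + c) = f x + τ c) →
      ∃ T : G →+ G, ∀ c ∈ A, T c = τ c := by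
  let p : (A →₀ ℤ) →ₗ[ℤ] G := Finsupp.linearCombination ℤ fun a : A => (a : G)
  let t (τ : G → G) : (A →₀ ℤ) →ₗ[ℤ] G := Finsupp.linearCombination ℤ fun a : A => τ a
  let P (m : A →₀ ℤ) : Prop := ∃ N : ℕ, ∀ s, ∀ f τ : G → G,
      (∀ x, wordLength A x ≤ s → ∀ c ∈ A, f (x + c) = f x + τ c) →
      ∀ x, wordLength A x + N ≤ s → f (x + p m) = f x + t τ m
  let S : AddSubgroup (A →₀ ℤ) :=
    { carrier := {m | P m}
      zero_mem' := ⟨0, by intro s f τ _ x _; simp⟩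
      add_mem' := by
        rintro m m' ⟨N, hN⟩ ⟨N', hN'⟩
        refine ⟨N + N' + wordLength A (p m), fun s f τ hf x hx => ?_⟩
        have h1 := hA.wordLength_add_le_add x (p m)
        rw [map_add, map_add, ← add_assoc, hN' s f τ hf _ (by omega), hN s f τ hf _ (by omega),
          add_assoc]
      neg_mem' := by
        rintro m ⟨N, hN⟩
        refine ⟨N + wordLength A (p (-m)), fun s f τ hf x hx => ?_⟩
        have h1 := hA.wordLength_add_le_add x (p (-m))
        have h2 := hN s f τ hf (x + p (-m)) (by omega)
        rw [map_neg, neg_add_cancel_right] at h2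
        rw [h2, map_neg, map_neg, add_neg_cancel_right] }
  have hP : ∀ m, P m := by
    intro m
    change m ∈ S
    induction m using Finsupp.induction_linear with
    | zero => exact S.zero_mem
    | add m m' h h' => exact S.add_mem h h'
    | single a n =>
      have h1 : Finsupp.single a (1 : ℤ) ∈ S := by
        refine ⟨0, fun s f τ hf x hx => ?_⟩
        simpa [p, t] using hf x (by omega) a a.2
      simpa using S.zsmul_mem h1 n
  choose N hN using hP
  have hsurj : Function.Surjective p := by
    rw [← LinearMap.range_eq_top, eq_top_iff]
    intro x _
    have hx : x ∈ AddSubgroup.closure (A : Set G) := by simp [hA.closure_eq]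
    have hle : AddSubgroup.closure (A : Set G) ≤ (LinearMap.range p).toAddSubgroup := by
      rw [AddSubgroup.closure_le]
      intro a ha
      exact ⟨Finsupp.single ⟨a, ha⟩ 1, by simp [p]⟩
    exact hle hx
  obtain ⟨Q, hQ⟩ := (IsNoetherian.noetherian (LinearMap.ker p) : (LinearMap.ker p).FG)
  refine ⟨Q.sup N, fun s hs f τ hf => ?_⟩
  have hker : LinearMap.ker p ≤ LinearMap.ker (t τ) := by
    rw [← hQ, Submodule.span_le]
    intro m hm
    have hm0 : p m = 0 := by
      rw [← LinearMap.mem_ker, ← hQ]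
      exact Submodule.subset_span hm
    have h1 := hN m s f τ hf 0 (by simpa using (Finset.le_sup hm).trans hs)
    simpa [hm0] using h1
  refine ⟨(((LinearMap.ker p).liftQ (t τ) hker).comp
    (p.quotKerEquivOfSurjective hsurj).symm.toLinearMap).toAddMonoidHom, fun c hc => ?_⟩
  have h1 : c = p.quotKerEquivOfSurjective hsurj
      (Submodule.Quotient.mk (Finsupp.single ⟨c, hc⟩ 1)) := by simp [p]
  have h2 : (p.quotKerEquivOfSurjective hsurj).symm c =
      Submodule.Quotient.mk (Finsupp.single ⟨c, hc⟩ 1) := by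
    rw [LinearEquiv.symm_apply_eq]; exact h1
  simp [h2, t]

/-! ### Rigidity up to the boundary of the ball -/

lemma IsSymmGenSet.wordLength_map_le (hA : IsSymmGenSet A) {T : G →+ G} (hT : ∀ a ∈ A, T a ∈ A)
    (x : G) : wordLength A (T x) ≤ wordLength A x := by
  obtain ⟨m, h1, h2, rfl⟩ := hA.exists_multiset x
  rw [← h2, map_multiset_sum]
  simpa using hA.wordLength_add_sum_le 0 (m.map T) (by
    intro b hb
    obtain ⟨a, ha, rfl⟩ := Multiset.mem_map.1 hb
    exact hT a (h1 a ha))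

namespace IsBallMap

variable {r : ℕ} {f : G → G} [Module.Free ℤ G]

/-- A ball map that is a translation on a large enough ball is a translation. If `f x = w + x + d`
with `x` on the next sphere and `a` is a non-midpoint with `x - 2a` two spheres below, then
`x - a` and `x - a + d` lie in the smaller ball, and adjacency to their images shows `a + d ∈ A`
and `a - d ∈ A`, so `d = 0`. -/
lemma eq_add_of_forall_le [Module.Finite ℤ G] (hA : IsSymmGenSet A) (hf : IsBallMap A r f)
    {s : ℕ} (hs : A.card ≤ s) {w : G} (h : ∀ x, wordLength A x ≤ s → f x = w + x)
    {x : G} (hx : wordLength A x ≤ r) : f x = w + x := by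
  induction hn : wordLength A x using Nat.strong_induction_on generalizing x with
  | _ n ih =>
    rcases le_or_gt (wordLength A x) s with hxs | hxs
    · exact h x hxs
    · obtain ⟨a, ha, h1⟩ := hA.exists_isNonMidpoint (hs.trans_lt hxs)
      set d := f x - w - x with hd
      have hfx : f x = w + x + d := by rw [hd]; abel
      have h2 : wordLength A (x - a) ≤ wordLength A (x - (a + a)) + 1 :=
        hA.wordLength_le_of_sub_mem (by convert ha.1 using 1; abel)
      have h3 := ih _ (by omega) (x := x - a) (by omega) rfl
      have h4 : a + d ∈ A := by
        have h5 := (hf.adj (x - a) x (by omega) hx).2 (by simpa using ha.1)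
        rw [hfx, h3] at h5
        convert h5 using 1
        abel
      have h5 : wordLength A (x - a + d) ≤ wordLength A (x - (a + a)) + 1 :=
        hA.wordLength_le_of_sub_mem (by convert h4 using 1; abel)
      have h6 := ih _ (by omega) (x := x - a + d) (by omega) rfl
      have h7 : a - d ∈ A := by
        have h8 := (hf.adj (x - a + d) x (by omega) hx).1 (by
          rw [hfx, h6]
          convert ha.1 using 1
          abel)
        convert h8 using 1
        abel
      have h8 := ha.2 _ h4 _ h7 (by abel)
      rw [hfx, add_eq_left.1 h8, add_zero]

lemma eq_zero_of_forall_eq_add (hA : IsSymmGenSet A) (hf : IsBallMap A r f) {w : G}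
    (h : ∀ x, wordLength A x ≤ r → f x = w + x) : w = 0 := by
  by_contra hw
  have hmem : ∀ k : ℕ, wordLength A (k • w) ≤ r := by
    intro k
    induction k with
    | zero => simp
    | succ k ih =>
      have h1 := hf.maps _ ih
      rwa [h _ ih, ← succ_nsmul'] at h1
  refine Set.infinite_of_injective_forall_mem (f := fun k : ℕ => k • w) ?_ hmem (hA.finite_ball r)
  intro k l hkl
  have h4 : (k : ℤ) • w = (l : ℤ) • w := by simpa using hkl
  exact_mod_cast smul_left_injective ℤ hw h4

end IsBallMap

/-- For `r` large, every automorphism of the ball of radius `r` is the restriction of an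
automorphism of the group `G` that preserves `A`. -/
theorem IsSymmGenSet.exists_addEquiv [Module.Free ℤ G] [Module.Finite ℤ G]
    (hA : IsSymmGenSet A) :
    ∃ R : ℕ, ∀ r, R ≤ r → ∀ f : G → G, IsBallMap A r f →
      ∃ T : G ≃+ G, (∀ x, T x ∈ A ↔ x ∈ A) ∧ ∀ x, wordLength A x ≤ r → f x = T x := by
  obtain ⟨N, hN⟩ := hA.exists_addMonoidHom
  set s := max N (A.card + 1) with hs
  refine ⟨s + A.card + 1, fun r hr f hf => ?_⟩
  have hmap : ∀ x, wordLength A x ≤ s → ∀ c ∈ A, f (x + c) = f x + (f c - f 0) :=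
    fun x hx c hc => hf.map_add hA (by omega) hr hx hc
  obtain ⟨T, hT⟩ := hN s (by omega) f (fun c => f c - f 0) hmap
  have hbij : Set.BijOn T A A := by
    refine (hf.bijOn_star hA (x := 0) (by simp; omega)).congr fun a ha => ?_
    simp [hT a ha]
  have hsurj : Function.Surjective T := by
    rw [← AddMonoidHom.range_eq_top, eq_top_iff, ← hA.closure_eq, AddSubgroup.closure_le]
    intro b hb
    obtain ⟨a, -, rfl⟩ := hbij.surjOn hb
    exact ⟨a, rfl⟩
  have hinj : Function.Injective T :=
    OrzechProperty.injective_of_surjective_endomorphism T.toIntLinearMap hsurj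
  let E : G ≃+ G := AddEquiv.ofBijective T ⟨hinj, hsurj⟩
  have hE : ∀ x, E x ∈ A ↔ x ∈ A := by
    intro x
    refine ⟨fun hx => ?_, fun hx => hbij.mapsTo hx⟩
    obtain ⟨a, ha, h⟩ := hbij.surjOn hx
    rwa [← hinj h]
  have hE' : ∀ x, E.symm x ∈ A ↔ x ∈ A := fun x => by rw [← hE, E.apply_symm_apply]
  have haff : ∀ n x, wordLength A x = n → n ≤ s → f x = f 0 + E x := by
    intro n
    induction n with
    | zero => intro x hx _; simp [hA.eq_zero_of_wordLength hx]
    | succ n ih =>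
      intro x hx hn
      obtain ⟨a, ha, h⟩ := hA.exists_wordLength_sub (x := x) (by omega)
      have h1 := hmap (x - a) (by omega) a ha
      have h2 : E a = f a - f 0 := hT a ha
      rw [sub_add_cancel, ih (x - a) (by omega) (by omega), ← h2, add_assoc, ← map_add,
        sub_add_cancel] at h1
      exact h1
  have hf' : IsBallMap A r (fun x => E.symm (f x)) :=
    { maps := fun x hx => (hA.wordLength_map_le (T := E.symm.toAddMonoidHom)
        (fun a ha => (hE' a).2 ha) (f x)).trans (hf.maps x hx)
      inj := fun x y hx hy hxy => hf.inj x y hx hy (E.symm.injective hxy)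
      adj := fun x y hx hy => by rw [← map_sub, hE', hf.adj x y hx hy] }
  have htrans : ∀ x, wordLength A x ≤ r → E.symm (f x) = E.symm (f 0) + x := fun x hx =>
    hf'.eq_add_of_forall_le hA (s := s) (by omega)
      (fun x hx => by rw [haff _ x rfl hx, map_add, E.symm_apply_apply]) hx
  have h0 := hf'.eq_zero_of_forall_eq_add hA htrans
  refine ⟨E, hE, fun x hx => ?_⟩
  have h1 := htrans x hx
  rwa [h0, zero_add, AddEquiv.symm_apply_eq] at h1

/-! ### Translation to graph isomorphisms and real coordinates -/

/-- An automorphism of `ℤ^k` extends to a linear automorphism of `ℝ^k`. -/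
lemma exists_linearEquiv_extending {k : ℕ} (S : (Fin k → ℤ) ≃+ (Fin k → ℤ)) :
    ∃ T : (Fin k → ℝ) ≃ₗ[ℝ] (Fin k → ℝ),
      ∀ v : Fin k → ℤ, (fun i => ((S v i : ℤ) : ℝ)) = T (fun i => ((v i : ℤ) : ℝ)) := by
  have hinv : ∀ S : (Fin k → ℤ) ≃+ (Fin k → ℤ),
      (LinearMap.toMatrix' S.toIntLinearEquiv.toLinearMap).map (Int.castRingHom ℝ) *
        (LinearMap.toMatrix' S.symm.toIntLinearEquiv.toLinearMap).map (Int.castRingHom ℝ) = 1 := by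
    intro S
    rw [← Matrix.map_mul, ← LinearMap.toMatrix'_comp]
    have h : S.toIntLinearEquiv.toLinearMap ∘ₗ S.symm.toIntLinearEquiv.toLinearMap =
        LinearMap.id := by
      ext1 i
      ext1
      simp
    rw [h, LinearMap.toMatrix'_id]
    exact Matrix.map_one _ (map_zero _) (map_one _)
  refine ⟨Matrix.toLin'OfInv (hinv S.symm) (hinv S), fun v => ?_⟩
  have h1 : S v = (LinearMap.toMatrix' S.toIntLinearEquiv.toLinearMap).mulVec v := by
    rw [LinearMap.toMatrix'_mulVec]; rfl
  ext i
  rw [h1]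
  simp [Matrix.toLin'OfInv, Matrix.mulVec, dotProduct]

namespace IsSymmGenSet

lemma mem_wordBallVerts (hA : IsSymmGenSet A) {x : G} {r : ℕ} :
    x ∈ wordBallVerts (A : Set G) r ↔ wordLength A x ≤ r := hA.edist_le_iff

open Classical in
lemma isBallMap_of_ballIso (hA : IsSymmGenSet A) {r : ℕ}
    (φ : wordBall (A : Set G) r ≃g wordBall (A : Set G) r) :
    IsBallMap A r fun x => if h : x ∈ wordBallVerts (A : Set G) r then (φ ⟨x, h⟩ : G) else 0 where
  maps x hx := by
    have hx' := hA.mem_wordBallVerts.2 hx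
    simpa only [hx', dite_true] using hA.mem_wordBallVerts.1 (φ ⟨x, hx'⟩).2
  inj x y hx hy h := by
    have hx' := hA.mem_wordBallVerts.2 hx
    have hy' := hA.mem_wordBallVerts.2 hy
    simp only [hx', hy', dite_true] at h
    simpa using φ.injective (Subtype.ext h)
  adj x y hx hy := by
    have hx' := hA.mem_wordBallVerts.2 hx
    have hy' := hA.mem_wordBallVerts.2 hy
    simp only [hx', hy', dite_true]
    have h : (wordBall (A : Set G) r).Adj (φ ⟨x, hx'⟩) (φ ⟨y, hy'⟩) ↔
        (wordBall (A : Set G) r).Adj ⟨x, hx'⟩ ⟨y, hy'⟩ := φ.map_adj_iff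
    simpa only [wordBall, comap_adj, Function.Embedding.subtype_apply, hA.adj_iff] using h

lemma isBallMap_of_iso (hA : IsSymmGenSet A)
    (ψ : addCayley (A : Set G) ≃g addCayley (A : Set G)) (h0 : ψ 0 = 0) (r : ℕ) :
    IsBallMap A r ψ where
  maps x hx := by
    obtain ⟨p, hp⟩ := hA.connected.exists_walk_length_eq_dist 0 x
    have h1 := dist_le (p.map ψ.toHom)
    rw [Walk.length_map, hp] at h1
    have h2 : ψ.toHom 0 = 0 := h0
    rw [h2] at h1
    exact h1.trans hx
  inj x y _ _ h := ψ.injective h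
  adj x y _ _ := by rw [← hA.adj_iff, ← hA.adj_iff, ψ.map_adj_iff]

/-- A group automorphism that preserves `A`, as an automorphism of the Cayley graph. -/
def cayleyIso (hA : IsSymmGenSet A) (T : G ≃+ G) (hT : ∀ x, T x ∈ A ↔ x ∈ A) :
    addCayley (A : Set G) ≃g addCayley (A : Set G) where
  toEquiv := T.toEquiv
  map_rel_iff' {x y} := by
    change (addCayley (A : Set G)).Adj (T x) (T y) ↔ _
    rw [hA.adj_iff, hA.adj_iff, ← map_sub, hT]

end IsSymmGenSet

end

theorem theorem2 {G : Type*} [AddCommGroup G] [Module.Free ℤ G] [Module.Finite ℤ G]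
    (A : Set G) (hfin : A.Finite) (hsymm : ∀ a ∈ A, -a ∈ A) (hzero : (0 : G) ∉ A)
    (hgen : AddSubgroup.closure A = ⊤) :
    ∃ R : ℕ, ∀ r : ℕ, R ≤ r → ∀ φ : wordBall A r ≃g wordBall A r,
      (∀ (k : ℕ) (e : G ≃+ (Fin k → ℤ)), IsLinearInCoords e φ) ∧
      ∃! ψ : SimpleGraph.addCayley A ≃g SimpleGraph.addCayley A,
        ψ 0 = 0 ∧ ∀ x : wordBallVerts A r, ψ (x : G) = (φ x : G) := by
  lift A to Finset G using hfin
  have hA : IsSymmGenSet A := ⟨hsymm, hzero, hgen⟩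
  obtain ⟨R, hR⟩ := hA.exists_addEquiv
  refine ⟨max R 1, fun r hr φ => ?_⟩
  obtain ⟨T, hTA, hT⟩ := hR r (by omega) _ (hA.isBallMap_of_ballIso φ)
  have hφ : ∀ x : wordBallVerts (A : Set G) r, (φ x : G) = T x := by
    rintro ⟨x, hx⟩
    simpa only [hx, dite_true] using hT x (hA.mem_wordBallVerts.1 hx)
  refine ⟨fun k e => ?_, hA.cayleyIso T hTA, ⟨map_zero T, fun x => (hφ x).symm⟩, ?_⟩
  · obtain ⟨U, hU⟩ := exists_linearEquiv_extending ((e.symm.trans T).trans e)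
    refine ⟨U, fun x => ?_⟩
    rw [← hU, hφ]
    simp
  · rintro ψ ⟨h0, hψ⟩
    ext x
    -- `ψ` is the restriction of a group automorphism on every large ball, in particular on one
    -- containing `x`; this automorphism agrees with `T` on `A`, as the ball of radius `r ≥ 1` does
    -- contain `A`.
    obtain ⟨T', -, hT'⟩ := hR (max r (wordLength A x)) (by omega) ψ
      (hA.isBallMap_of_iso ψ h0 _)
    have hEq : Set.EqOn T' T (A : Set G) := by
      intro a ha
      have h1 : wordLength A a ≤ 1 := by simpa using hA.wordLength_add_le 0 ha
      rw [← hT' a (by omega), ← hφ ⟨a, hA.mem_wordBallVerts.2 (by omega)⟩]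
      exact hψ ⟨a, _⟩
    have hTT : (T' : G →+ G) = T := AddMonoidHom.eq_of_eqOn_dense hgen hEq
    rw [hT' x (le_max_right _ _)]
    exact DFunLike.congr_fun hTT x
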